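/- Conventions. A finite two-player game $\mathcal G$ consists of finite non-empty action sets $S_1,S_2$ and payoff functions $u_1,u_2:S_1\times S_2\to\mathbb R$; $u_i$ is extended to mixed strategies by expectation. For infinite action sequences $s_i=(s_i(j))_{j\ge1}\in S_i^{\mathbb N}$ the payoff in the unfolding of $\mathcal G$ is $$u_i^{\mathfrak{uf}}(s_1,s_2)=\liminf_{N\to\infty}\frac1N\sum_{j=1}^N u_i(s_1(j),s_2(j)).$$ A player with rationality level $\tau\ge1$ may play exactly the eventually repeated sequences $x\,y\,y\,y\cdots$ with $x$ a finite (possibly empty) prefix and $y$ a block of length $\tau$ (which may itself be a repetition of a shorter block). For $\varepsilon\in\mathbb R$, a profile $(s_1,s_2)$ of such sequences, for rationality levels $(\tau_1,\tau_2)$, is an $\varepsilon$-NE of the unfolding if no player can raise his or her payoff $u_i^{\mathfrak{uf}}$ by more than $\varepsilon$ by changing only his or her own sequence to another one of the same rationality level. The folding of a sequence $s_i$ is its frequency vector $\mu_i(a)=\lim_{N\to\infty}\frac1N|\{1\le j\le N:s_i(j)=a\}|$, $a\in S_i$. A player is almost rational if the rationality level is a sequence $(\tau(n))_{n\ge1}$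 of positive integers with $\tau(n)\to\infty$. Given two almost rational players with levels $(\tau_1(n))$, $(\tau_2(n))$, a sequence of profiles $s^{(n)}=(s_1^{(n)},s_2^{(n)})$ is a Nash equilibrium for the almost rational players if there are $\varepsilon_n\to0$ such that, for every $n$, $s^{(n)}$ is an $\varepsilon_n$-NE of the unfolding of $\mathcal G$ with rationality levels $(\tau_1(n),\tau_2(n))$. The levels are almost coprime if $$\lim_{n\to\infty}\frac{\gcd(\tau_1(n),\tau_2(n))}{\tau_1(n)}=0\quad\text{and}\quad\lim_{n\to\infty}\frac{\gcd(\tau_1(n),\tau_2(n))}{\tau_2(n)}=0,$$ equivalently $\gcd(\tau_1(n),\tau_2(n))/\min\{\tau_1(n),\tau_2(n)\}\to0$. Theorem. Let two almost rational players have rationality levels $(\tau_1(n))_{n\ge1}$ and $(\tau_2(n))_{n\ge1}$. The following are equivalent: 1. The sequences $(\tau_1(n))$ and $(\tau_2(n))$ are almost coprime. 2. For every finite two-player game $\mathcal G$ there is a sequence of profiles $(s^{(n)})_{n\ge1}$ that is a Nash equilibrium for the almost rational players. Moreover, if the levels are almost coprime, then for every finite two-player game $\mathcal G$ and every (mixed)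 Nash equilibrium $\sigma^*=(\sigma_1^*,\sigma_2^*)$ of $\mathcal G$ there is a sequence of profiles $s^{(n)}=(s_1^{(n)},s_2^{(n)})$ such that (a) $(s^{(n)})$ is a Nash equilibrium for the almost rational players; (b) for $i=1,2$ and every $n$ the folding $\mu_i^{(n)}$ of $s_i^{(n)}$ exists, and $\mu_i^{(n)}(a)\to\sigma_i^*(a)$ for every $a\in S_i$; (c) for $i=1,2$, $u_i^{\mathfrak{uf}}(s^{(n)})\to u_i(\sigma^*)$. -/

import Mathlib

open Filter Topology

universe u v

namespace UnfoldingGame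

/-- A two-player normal-form game with action sets `S₁`, `S₂` (finiteness and non-emptiness of the
action sets are instance hypotheses wherever a game is used) and real payoffs. -/
structure Game (S₁ : Type u) (S₂ : Type v) where
  /-- payoff of player 1 -/
  u₁ : S₁ → S₂ → ℝ
  /-- payoff of player 2 -/
  u₂ : S₁ → S₂ → ℝ

section Original

variable {S₁ : Type u} {S₂ : Type v} [Fintype S₁] [Fintype S₂]

/-- Expected payoff of a mixed strategy profile, for the payoff function `w`.  A mixed strategy is a
point of the standard simplex over the action set. -/
noncomputable def expectedPayoff (w : S₁ → S₂ → ℝ)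
    (σ₁ : stdSimplex ℝ S₁) (σ₂ : stdSimplex ℝ S₂) : ℝ :=
  ∑ a, ∑ b, σ₁.1 a * σ₂.1 b * w a b

/-- Nash equilibrium, in mixed strategies, of the original normal-form game. -/
def Game.IsNash (G : Game S₁ S₂) (σ₁ : stdSimplex ℝ S₁) (σ₂ : stdSimplex ℝ S₂) : Prop :=
  (∀ σ₁' : stdSimplex ℝ S₁, expectedPayoff G.u₁ σ₁' σ₂ ≤ expectedPayoff G.u₁ σ₁ σ₂) ∧
  (∀ σ₂' : stdSimplex ℝ S₂, expectedPayoff G.u₂ σ₁ σ₂' ≤ expectedPayoff G.u₂ σ₁ σ₂)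

end Original

section Unfolding

variable {S₁ : Type u} {S₂ : Type v}

/-- Long-run average payoff of a profile of infinite action sequences.  Rounds are numbered
`0, 1, 2, …`, so the sum over `Finset.range N` runs over the first `N` rounds. -/
noncomputable def unfoldingPayoff (w : S₁ → S₂ → ℝ) (s₁ : ℕ → S₁) (s₂ : ℕ → S₂) : ℝ :=
  liminf (fun N : ℕ => (1 / (N : ℝ)) * ∑ j ∈ Finset.range N, w (s₁ j) (s₂ j)) atTop

/-- The strategy space at rationality level `τ`: sequences of the form `x y y y …` with `x` a finite
prefix (here of length `k`) and `y` a block of length `τ`.  The block may itself be a repetition of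
a shorter one. -/
def strategySpace (S : Type u) (τ : ℕ) : Set (ℕ → S) :=
  {s | 0 < τ ∧ ∃ k : ℕ, ∀ j, k ≤ j → s (j + τ) = s j}

/-- `(s₁, s₂)` is an `ε`-approximate Nash equilibrium of the unfolding game with rationality levels
`τ₁`, `τ₂`. -/
def Game.IsEpsNash (G : Game S₁ S₂) (τ₁ τ₂ : ℕ) (ε : ℝ) (s₁ : ℕ → S₁) (s₂ : ℕ → S₂) : Prop :=
  s₁ ∈ strategySpace S₁ τ₁ ∧ s₂ ∈ strategySpace S₂ τ₂ ∧
  (∀ s₁' ∈ strategySpace S₁ τ₁, unfoldingPayoff G.u₁ s₁' s₂ - unfoldingPayoff G.u₁ s₁ s₂ ≤ ε) ∧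
  (∀ s₂' ∈ strategySpace S₂ τ₂, unfoldingPayoff G.u₂ s₁ s₂' - unfoldingPayoff G.u₂ s₁ s₂ ≤ ε)

/-- Nash equilibrium for almost rational agents: a sequence of profiles, the `n`-th of which is an
`ε n`-approximate Nash equilibrium of the `n`-th unfolding game, where `ε n → 0`. -/
def Game.IsAlmostRationalNash (G : Game S₁ S₂) (τ₁ τ₂ : ℕ → ℕ)
    (s₁ : ℕ → ℕ → S₁) (s₂ : ℕ → ℕ → S₂) : Prop :=
  ∃ ε : ℕ → ℝ, Tendsto ε atTop (𝓝 0) ∧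
    ∀ n, G.IsEpsNash (τ₁ n) (τ₂ n) (ε n) (s₁ n) (s₂ n)

end Unfolding

open Classical in
/-- `μ` is the folding of the sequence `s`: the limiting frequency of every action `a` along `s`
exists and equals `μ a`. -/
def IsFolding {S : Type u} [Fintype S] (s : ℕ → S) (μ : stdSimplex ℝ S) : Prop :=
  ∀ a, Tendsto
    (fun N : ℕ => (1 / (N : ℝ)) * (((Finset.range N).filter (fun j => s j = a)).card : ℝ))
    atTop (𝓝 (μ.1 a))

/-- Rationality levels of an almost rational player: positive integers tending to infinity. -/
def IsAlmostRational (τ : ℕ → ℕ) : Prop :=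
  (∀ n, 0 < τ n) ∧ Tendsto τ atTop atTop

/-- Almost coprime sequences of natural numbers. -/
def AlmostCoprime (a b : ℕ → ℕ) : Prop :=
  Tendsto (fun n => (Nat.gcd (a n) (b n) : ℝ) / (a n : ℝ)) atTop (𝓝 0) ∧
  Tendsto (fun n => (Nat.gcd (a n) (b n) : ℝ) / (b n : ℝ)) atTop (𝓝 0)

/-- The conclusion of the correspondence of equilibria for the mixed profile `(σ₁, σ₂)`: some Nash
equilibrium for almost rational agents has foldings converging to `(σ₁, σ₂)` and payoffs converging
to the expected payoffs of `(σ₁, σ₂)`. -/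
def Game.IsRealizedInUnfolding {S₁ : Type u} {S₂ : Type v} [Fintype S₁] [Fintype S₂]
    (G : Game S₁ S₂) (τ₁ τ₂ : ℕ → ℕ) (σ₁ : stdSimplex ℝ S₁) (σ₂ : stdSimplex ℝ S₂) : Prop :=
  ∃ (s₁ : ℕ → ℕ → S₁) (s₂ : ℕ → ℕ → S₂),
    G.IsAlmostRationalNash τ₁ τ₂ s₁ s₂ ∧
    (∃ μ₁ : ℕ → stdSimplex ℝ S₁, (∀ n, IsFolding (s₁ n) (μ₁ n)) ∧
      ∀ a, Tendsto (fun n => (μ₁ n).1 a) atTop (𝓝 (σ₁.1 a))) ∧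
    (∃ μ₂ : ℕ → stdSimplex ℝ S₂, (∀ n, IsFolding (s₂ n) (μ₂ n)) ∧
      ∀ b, Tendsto (fun n => (μ₂ n).1 b) atTop (𝓝 (σ₂.1 b))) ∧
    Tendsto (fun n => unfoldingPayoff G.u₁ (s₁ n) (s₂ n)) atTop
      (𝓝 (expectedPayoff G.u₁ σ₁ σ₂)) ∧
    Tendsto (fun n => unfoldingPayoff G.u₂ (s₁ n) (s₂ n)) atTop
      (𝓝 (expectedPayoff G.u₂ σ₁ σ₂))

end UnfoldingGame

namespace UnfoldingGame

/-! ### Fixed points of bounded smooth maps, by volume extrapolation -/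

section FixedPoint

open MeasureTheory Metric

/-! Write `τ₁ = d * k` and `τ₂ = d * m` with `d` the gcd, so `k` and `m` are coprime. Let player 2
hold each entry of a block of length `m` for `d` rounds (`spread`). Advancing `d * k` rounds fixes
the phase of player 1 and shifts the block index by `k`, a generator modulo `m`. Hence each phase of
player 1 meets every entry equally often, and the payoff is exactly that of independent mixing with
the two frequency vectors (`unfoldingPayoff_spread`). Almost coprimeness says `k, m → ∞`, so the
blocks approximate any mixed equilibrium and the gains from deviating vanish. This realizes every
Nash equilibrium.

Existence for every game then needs Nash's theorem. It is obtained from logit equilibria, which are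
fixed points of a bounded smooth map, as the temperature goes to zero. The fixed point theorem rests
on the Milnor–Rogers argument: a polynomial in `t` giving the volume of a deformed ball is constant
for small `t`, hence constant.

Conversely, suppose `k < K` and consider zero-sum pennies whose solution plays `true` with
probability `1 / K`. Within a residue class modulo `d`, player 1's frequency is a multiple of `1 /
k`, never `1 / K`, so a `d`-periodic reply wins at least `1 / K ^ 2`
(`exists_biasedPennies_exploit`). Player 1 can always secure `0`, so the profile is no approximate
equilibrium for small errors. -/

theorem exists_extrapolation_weights {ε : ℝ} (hε : 0 < ε) (n : ℕ) :
    ∃ v c : ℕ → ℝ, (∀ i, 0 < v i ∧ v i ≤ ε) ∧ ∑ i ∈ Finset.range (n + 1), c i = 1 ∧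
      ∀ p : Polynomial ℝ, p.natDegree ≤ n →
        p.eval 1 = ∑ i ∈ Finset.range (n + 1), c i * p.eval (v i) := by
  let v : ℕ → ℝ := fun i => ε / (i + 1)
  have hv : Set.InjOn v (Finset.range (n + 1)) := by
    intro i _ j _ hij
    have hi : (0 : ℝ) < (i : ℝ) + 1 := by positivity
    have hj : (0 : ℝ) < (j : ℝ) + 1 := by positivity
    simp only [v] at hij
    rw [div_eq_div_iff hi.ne' hj.ne'] at hij
    have := mul_left_cancel₀ hε.ne' hij
    exact_mod_cast (add_right_cancel this).symm
  have key : ∀ p : Polynomial ℝ, p.natDegree ≤ n →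
      p.eval 1 = ∑ i ∈ Finset.range (n + 1),
        (Lagrange.basis (Finset.range (n + 1)) v i).eval 1 * p.eval (v i) := by
    intro p hp
    have hdeg : p.degree < (Finset.range (n + 1)).card := by
      rw [Finset.card_range]
      exact (Polynomial.degree_le_of_natDegree_le hp).trans_lt (by exact_mod_cast Nat.lt_succ_self n)
    conv_lhs => rw [Lagrange.eq_interpolate hv hdeg]
    simp [Lagrange.interpolate_apply, Polynomial.eval_finsetSum, mul_comm]
  refine ⟨v, fun i => (Lagrange.basis (Finset.range (n + 1)) v i).eval 1, fun i => ⟨?_, ?_⟩, ?_, key⟩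
  · simp only [v]; positivity
  · simp only [v]
    exact div_le_self hε.le (by linarith [(Nat.cast_nonneg i : (0 : ℝ) ≤ i)])
  · simpa using (key 1 (by simp)).symm

variable {E : Type*} [NormedAddCommGroup E] [InnerProductSpace ℝ E]

/-- A segment leaving the ball crosses the sphere, where `G` vanishes, so cutting `G` off to zero
does not worsen the Lipschitz constant. -/
theorem lipschitzWith_indicator_ball {G : E → E} {R : ℝ} {K : NNReal}
    (hG : LipschitzOnWith K G (closedBall 0 R)) (h0 : ∀ x, ‖x‖ = R → G x = 0) :
    LipschitzWith K ((ball (0 : E) R).indicator G) := by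
  have mixed : ∀ x y : E, ‖x‖ < R → R ≤ ‖y‖ → ‖G x‖ ≤ K * dist x y := by
    intro x y hx hy
    have hc : ContinuousOn (fun t : ℝ => ‖AffineMap.lineMap x y t‖) (Set.Icc 0 1) :=
      (AffineMap.lineMap_continuous.norm).continuousOn
    obtain ⟨t, ht, htR⟩ := intermediate_value_Icc zero_le_one hc
      (show R ∈ Set.Icc _ _ by simpa using ⟨hx.le, hy⟩)
    have hz := hG.dist_le_mul x (by simpa using hx.le) (AffineMap.lineMap x y t)
      (by simpa using htR.le)
    rw [h0 _ htR, dist_zero_right, dist_left_lineMap] at hz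
    refine hz.trans (mul_le_mul_of_nonneg_left ?_ K.2)
    rw [Real.norm_of_nonneg ht.1]
    exact mul_le_of_le_one_left dist_nonneg ht.2
  refine LipschitzWith.of_dist_le_mul fun x y => ?_
  by_cases hx : ‖x‖ < R <;> by_cases hy : ‖y‖ < R
  · simpa [Set.indicator, hx, hy] using hG.dist_le_mul x (by simpa using hx.le) y (by simpa using hy.le)
  · simpa [Set.indicator, hx, hy] using mixed x y hx (not_lt.1 hy)
  · simpa [Set.indicator, hx, hy, dist_comm] using mixed y x hy (not_lt.1 hx)
  · simp [Set.indicator, hx, hy]; positivity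

variable [FiniteDimensional ℝ E]

theorem exists_polynomial_det_one_add_smul (A : E →L[ℝ] E) :
    ∃ p : Polynomial ℝ, p.natDegree ≤ Module.finrank ℝ E ∧
      ∀ t : ℝ, p.eval t = (1 + t • A : E →L[ℝ] E).det := by
  let b := Module.finBasis ℝ E
  let M := LinearMap.toMatrix b b (A : E →ₗ[ℝ] E)
  refine ⟨((Polynomial.X : Polynomial ℝ) • M.map Polynomial.C +
    (1 : Matrix _ _ ℝ).map Polynomial.C).det, ?_, fun t => ?_⟩
  · simpa using Polynomial.natDegree_det_X_add_C_le M 1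
  · rw [← Polynomial.coe_evalRingHom, RingHom.map_det]
    have : (1 + t • A : E →L[ℝ] E).det
        = (LinearMap.toMatrix b b ((1 + t • A : E →L[ℝ] E) : E →ₗ[ℝ] E)).det := by
      rw [LinearMap.det_toMatrix]
    rw [this]
    congr 1
    ext i j
    simp [M, LinearMap.toMatrix_apply, Matrix.one_apply, Finsupp.single_apply, eq_comm]
    split_ifs <;> simp [mul_comm, add_comm]

theorem bijective_add_smul_of_lipschitzWith {G : E → E} {K : NNReal} (hG : LipschitzWith K G)
    {t : ℝ} (ht : 0 ≤ t) (htK : t * K < 1) : Function.Bijective (fun x => x + t • G x) := by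
  have happ : ApproximatesLinearOn (fun x => x + t • G x)
      ((ContinuousLinearEquiv.refl ℝ E : E ≃L[ℝ] E) : E →L[ℝ] E) Set.univ (Real.toNNReal t * K) := by
    intro x _ y _
    have : x + t • G x - (y + t • G y) -
        ((ContinuousLinearEquiv.refl ℝ E : E ≃L[ℝ] E) : E →L[ℝ] E) (x - y) = t • (G x - G y) := by
      simp [smul_sub]; abel
    simp only
    rw [this, norm_smul, Real.norm_of_nonneg ht, NNReal.coe_mul, Real.coe_toNNReal _ ht, mul_assoc]
    exact mul_le_mul_of_nonneg_left (by simpa [dist_eq_norm] using hG.dist_le_mul x y) ht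
  have hc : Subsingleton E ∨ (Real.toNNReal t * K) <
      ‖((ContinuousLinearEquiv.refl ℝ E).symm : E →L[ℝ] E)‖₊⁻¹ := by
    rcases subsingleton_or_nontrivial E with h | h
    · exact Or.inl h
    · right
      have : ‖((ContinuousLinearEquiv.refl ℝ E).symm : E →L[ℝ] E)‖₊ = 1 := by
        ext; exact ContinuousLinearMap.norm_id
      rw [this, inv_one, ← NNReal.coe_lt_coe]
      simpa [Real.coe_toNNReal _ ht] using htK
  exact (happ.toHomeomorph _ hc).bijective

/-- For small `t` the map `x + t • G x` permutes the ball, so the integral of its Jacobian is the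
volume. The integrand is polynomial in `t`, so the identity extrapolates to `t = 1`. -/
theorem setIntegral_det_one_add_fderiv [MeasurableSpace E] [BorelSpace E] {G : E → E} (hG : ContDiff ℝ 1 G) {R : ℝ}
    (h0 : ∀ x, ‖x‖ = R → G x = 0) :
    ∫ x in ball (0 : E) R, (1 + fderiv ℝ G x).det = volume.real (ball (0 : E) R) := by
  have hG' : Continuous (fderiv ℝ G) := hG.continuous_fderiv one_ne_zero
  obtain ⟨K, hK⟩ := (isCompact_closedBall (0 : E) R).exists_bound_of_continuousOn hG'.continuousOn
  obtain ⟨L, hKL⟩ : ∃ L : NNReal, K ≤ L := ⟨K.toNNReal, Real.le_coe_toNNReal K⟩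
  have hLip : LipschitzOnWith L G (closedBall 0 R) :=
    (convex_closedBall (0 : E) R).lipschitzOnWith_of_nnnorm_fderiv_le
      (fun x _ => (hG.differentiable one_ne_zero) x)
      (fun x hx => by
        rw [← NNReal.coe_le_coe, coe_nnnorm]
        exact (hK x hx).trans hKL)
  have hLip' := lipschitzWith_indicator_ball hLip h0
  have hL0 : (0 : ℝ) ≤ L := NNReal.coe_nonneg _
  -- Positivity near the identity removes the absolute value in the change of variables.
  obtain ⟨δ, hδ, hdet⟩ : ∃ δ > 0, ∀ B : E →L[ℝ] E, dist B 1 < δ → 0 < B.det := by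
    have hc : ContinuousAt (fun B : E →L[ℝ] E => B.det) 1 :=
      ContinuousLinearMap.continuous_det.continuousAt
    have h1 : (0 : ℝ) < (1 : E →L[ℝ] E).det := by
      have : (1 : E →L[ℝ] E).det = 1 := LinearMap.det_id
      rw [this]; exact one_pos
    exact Metric.eventually_nhds_iff.1 (hc.eventually (lt_mem_nhds h1))
  obtain ⟨ε, hε, hε1, hεδ⟩ : ∃ ε : ℝ, 0 < ε ∧ ε * L < 1 ∧ ε * L < δ := by
    refine ⟨min 1 δ / (2 * (L + 1)), by positivity, ?_, ?_⟩
    · rw [div_mul_eq_mul_div, div_lt_iff₀ (by positivity)]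
      nlinarith [min_le_left 1 δ]
    · rw [div_mul_eq_mul_div, div_lt_iff₀ (by positivity)]
      nlinarith [min_le_right 1 δ]
  obtain ⟨v, c, hv, hc1, hc⟩ := exists_extrapolation_weights hε (Module.finrank ℝ E)
  have hdecomp : ∀ A : E →L[ℝ] E, (1 + A).det =
      ∑ i ∈ Finset.range (Module.finrank ℝ E + 1), c i * (1 + v i • A).det := by
    intro A
    obtain ⟨p, hp, hpe⟩ := exists_polynomial_det_one_add_smul A
    have := hc p hp
    simpa [hpe] using this
  have hsmall : ∀ t : ℝ, 0 < t → t ≤ ε →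
      ∫ x in ball (0 : E) R, (1 + t • fderiv ℝ G x).det = volume.real (ball (0 : E) R) := by
    intro t ht htε
    have htL : t * L ≤ ε * L := mul_le_mul_of_nonneg_right htε hL0
    have hbij := bijective_add_smul_of_lipschitzWith hLip' ht.le (htL.trans_lt hε1)
    set ψ : E → E := fun x => x + t • (ball (0 : E) R).indicator G x with hψ
    have hout : ∀ x, x ∉ ball (0 : E) R → ψ x = x := fun x hx => by simp [ψ, hx]
    -- A bijection fixing the complement pointwise preserves the ball.
    have himg : ψ '' ball 0 R = ball 0 R := by
      have hcompl : ψ '' (ball 0 R)ᶜ = (ball 0 R)ᶜ := by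
        exact (Set.image_congr (s := (ball (0 : E) R)ᶜ) hout).trans (Set.image_id' _)
      rw [Set.image_compl_eq hbij] at hcompl
      exact compl_injective hcompl
    have hder : ∀ x ∈ ball (0 : E) R,
        HasFDerivWithinAt ψ (1 + t • fderiv ℝ G x) (ball 0 R) x := by
      intro x hx
      have h1 : HasFDerivAt (fun x => x + t • G x) (1 + t • fderiv ℝ G x) x :=
        (hasFDerivAt_id x).add (((hG.differentiable one_ne_zero) x).hasFDerivAt.const_smul t)
      exact h1.hasFDerivWithinAt.congr (fun y hy => by simp only [ψ, Set.indicator_of_mem hy])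
        (by simp only [ψ, Set.indicator_of_mem hx])
    have hcv := integral_image_eq_integral_abs_det_fderiv_smul volume measurableSet_ball hder
      hbij.injective.injOn (fun _ => (1 : ℝ))
    rw [himg] at hcv
    simp only [smul_eq_mul, mul_one, integral_const, MeasurableSet.univ, measureReal_restrict_apply,
      Set.univ_inter] at hcv
    rw [hcv]
    refine setIntegral_congr_fun measurableSet_ball fun x hx => ?_
    refine (abs_of_pos (hdet _ ?_)).symm
    rw [dist_eq_norm, add_sub_cancel_left, norm_smul, Real.norm_of_nonneg ht.le]
    refine lt_of_le_of_lt (le_trans (mul_le_mul_of_nonneg_left ?_ ht.le) htL) hεδ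
    exact (hK x (ball_subset_closedBall hx)).trans hKL
  have hint : ∀ t : ℝ, IntegrableOn (fun x => (1 + t • fderiv ℝ G x).det) (ball (0 : E) R) := by
    intro t
    have : Continuous (fun x => (1 + t • fderiv ℝ G x).det) :=
      ContinuousLinearMap.continuous_det.comp (continuous_const.add (hG'.const_smul t))
    exact (this.continuousOn.integrableOn_compact (isCompact_closedBall (0 : E) R)).mono_set
      ball_subset_closedBall
  rw [integral_congr_ae (Eventually.of_forall fun x => hdecomp (fderiv ℝ G x))]
  rw [integral_finsetSum _ (fun i _ => (hint (v i)).const_mul (c i))]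
  simp_rw [integral_const_mul]
  rw [Finset.sum_congr rfl fun i _ => by rw [hsmall (v i) (hv i).1 (hv i).2], ← Finset.sum_mul,
    hc1, one_mul]

/-- Otherwise `R φ / ‖φ‖` retracts the ball onto its sphere: its Jacobian vanishes, yet integrates
to the volume of the ball. -/
theorem exists_eq_zero_of_eq_id_outside {φ : E → E} (hφ : ContDiff ℝ 1 φ) {R : ℝ} (hR : 0 < R)
    (hid : ∀ x, R ≤ ‖x‖ → φ x = x) : ∃ x, φ x = 0 := by
  by_contra! hne
  borelize E
  let f : E → E := fun x => (R * ‖φ x‖⁻¹) • φ x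
  have hf : ContDiff ℝ 1 f :=
    (contDiff_const.mul ((hφ.norm ℝ hne).inv fun x => norm_ne_zero_iff.2 (hne x))).smul hφ
  have hfn : ∀ x, ‖f x‖ = R := fun x => by
    have : ‖φ x‖ ≠ 0 := norm_ne_zero_iff.2 (hne x)
    simp only [f]
    rw [norm_smul, norm_mul, norm_inv, norm_norm, Real.norm_of_nonneg hR.le, mul_assoc,
      inv_mul_cancel₀ this, mul_one]
  have hint := setIntegral_det_one_add_fderiv (G := fun x => f x - x) (hf.sub contDiff_id) (R := R)
    (fun x hx => by
      simp only [f]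
      rw [hid x hx.ge, hx, mul_inv_cancel₀ hR.ne', one_smul, sub_self])
  have hzero : ∀ x, (1 + fderiv ℝ (fun x => f x - x) x).det = 0 := by
    intro x
    have hdf := (hf.differentiable one_ne_zero) x
    have hd : 1 + fderiv ℝ (fun x => f x - x) x = fderiv ℝ f x := by
      have : fderiv ℝ (fun x => f x - x) x = fderiv ℝ f x - 1 :=
        (hdf.hasFDerivAt.sub (hasFDerivAt_id x)).fderiv
      rw [this]; abel
    rw [hd]
    by_contra hdet
    have hunit : IsUnit (LinearMap.det (fderiv ℝ f x : E →ₗ[ℝ] E)) := isUnit_iff_ne_zero.2 hdet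
    -- Differentiating the constant `‖f‖ ^ 2` in a direction that the derivative sends to `f x`
    -- would give `2 * R ^ 2 = 0`.
    obtain ⟨w, hw⟩ := (LinearMap.equivOfIsUnitDet hunit).surjective (f x)
    have hw' : fderiv ℝ f x w = f x := by simpa using hw
    have h1 := (hdf.hasFDerivAt.norm_sq).unique
      ((hasFDerivAt_const (R ^ 2) x).congr_of_eventuallyEq
        (Eventually.of_forall fun y => by simp only [hfn]))
    have h2 := congrArg (fun T => T w) h1
    simp only [ContinuousLinearMap.comp_apply, _root_.smul_apply, hw',
      innerSL_apply_apply, real_inner_self_eq_norm_sq, hfn, _root_.zero_apply] at h2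
    have : R ^ 2 ≠ 0 := by positivity
    simp at h2
    exact hR.ne' h2
  simp only [hzero, integral_zero] at hint
  have hpos : 0 < volume.real (ball (0 : E) R) :=
    ENNReal.toReal_pos (measure_ball_pos volume _ hR).ne' measure_ball_lt_top.ne
  exact hpos.ne hint

/-- A bounded continuously differentiable self-map of a Euclidean space has a fixed point. -/
theorem exists_fixedPoint_of_bounded {h : E → E} (hh : ContDiff ℝ 1 h) {M : ℝ}
    (hM : ∀ x, ‖h x‖ ≤ M) : ∃ x, h x = x := by
  have hM0 : 0 ≤ M := (norm_nonneg _).trans (hM 0)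
  let χ : ContDiffBump (0 : E) := ⟨M + 1, M + 2, by linarith, by linarith⟩
  obtain ⟨x, hx⟩ := exists_eq_zero_of_eq_id_outside (φ := fun x => x - χ x • h x)
    (contDiff_id.sub (χ.contDiff.smul hh)) (R := M + 2) (by linarith)
    (fun x hx => by
      rw [χ.zero_of_le_dist (by simpa using hx), zero_smul, sub_zero])
  have hx' : x = χ x • h x := sub_eq_zero.1 hx
  have hnorm : ‖x‖ ≤ M := by
    rw [hx', norm_smul, Real.norm_of_nonneg χ.nonneg]
    exact (mul_le_of_le_one_left (norm_nonneg _) χ.le_one).trans (hM x)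
  refine ⟨x, ?_⟩
  rw [χ.one_of_mem_closedBall (by simp [χ]; linarith), one_smul] at hx'
  exact hx'.symm

end FixedPoint

/-! ### Softmax and its regret -/

section Softmax

variable {ι : Type*} [Fintype ι]

noncomputable def softmax (x : ι → ℝ) (a : ι) : ℝ := Real.exp (x a) / ∑ b, Real.exp (x b)

variable [Nonempty ι]

theorem sum_exp_pos (x : ι → ℝ) : 0 < ∑ b, Real.exp (x b) :=
  Finset.sum_pos (fun _ _ => Real.exp_pos _) Finset.univ_nonempty

theorem softmax_mem_stdSimplex (x : ι → ℝ) : softmax x ∈ stdSimplex ℝ ι := by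
  refine ⟨fun a => div_nonneg (Real.exp_pos _).le (sum_exp_pos x).le, ?_⟩
  simp only [softmax]
  rw [← Finset.sum_div, div_self (sum_exp_pos x).ne']

/-- An action worse than `b` by `t` has weight at most `exp (-t)`, and `t * exp (-t) ≤ 1`. The error
does not grow with the scale of `x`, so multiplying payoffs by `l` divides the regret by `l`. -/
theorem le_sum_softmax_mul (x : ι → ℝ) (b : ι) :
    x b ≤ ∑ a, softmax x a * x a + Fintype.card ι := by
  have h1 : x b = ∑ a, softmax x a * x b := by
    rw [← Finset.sum_mul, (softmax_mem_stdSimplex x).2, one_mul]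
  have h2 : ∑ a, softmax x a * (x b - x a) ≤ ∑ _a : ι, (1 : ℝ) := by
    refine Finset.sum_le_sum fun a _ => ?_
    have hp : 0 ≤ softmax x a := (softmax_mem_stdSimplex x).1 a
    rcases le_or_gt (x b) (x a) with h | h
    · nlinarith
    · have hle : softmax x a ≤ Real.exp (x a) / Real.exp (x b) :=
        div_le_div_of_nonneg_left (Real.exp_pos _).le (Real.exp_pos _)
          (Finset.single_le_sum (f := fun c => Real.exp (x c)) (fun _ _ => (Real.exp_pos _).le)
            (Finset.mem_univ b))
      rw [← Real.exp_sub] at hle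
      calc softmax x a * (x b - x a) ≤ Real.exp (x a - x b) * Real.exp (x b - x a) :=
            mul_le_mul hle (by linarith [Real.add_one_le_exp (x b - x a)]) (by linarith)
              (Real.exp_pos _).le
        _ = 1 := by rw [← Real.exp_add]; simp
  simp only [mul_sub, Finset.sum_sub_distrib, Finset.sum_const, Finset.card_univ, nsmul_eq_mul,
    mul_one] at h2
  linarith

theorem contDiff_softmax_apply (a : ι) : ContDiff ℝ 1 (fun x : ι → ℝ => softmax x a) :=
  ((contDiff_apply ℝ ℝ a).exp).div
    (ContDiff.sum fun b _ => (contDiff_apply ℝ ℝ b).exp) (fun x => (sum_exp_pos x).ne')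

end Softmax

/-! ### Nash's theorem through logit equilibria -/

section Nash

variable {S₁ : Type u} {S₂ : Type v} [Fintype S₁] [Fintype S₂]

theorem expectedPayoff_eq_sum_left (w : S₁ → S₂ → ℝ) (σ₁ : stdSimplex ℝ S₁)
    (σ₂ : stdSimplex ℝ S₂) :
    expectedPayoff w σ₁ σ₂ = ∑ a, σ₁.1 a * ∑ b, σ₂.1 b * w a b := by
  simp only [expectedPayoff, Finset.mul_sum, mul_assoc]

theorem expectedPayoff_swap (w : S₁ → S₂ → ℝ) (σ₁ : stdSimplex ℝ S₁)
    (σ₂ : stdSimplex ℝ S₂) :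
    expectedPayoff (fun b a => w a b) σ₂ σ₁ = expectedPayoff w σ₁ σ₂ := by
  simp only [expectedPayoff]
  rw [Finset.sum_comm]
  exact Finset.sum_congr rfl fun a _ => Finset.sum_congr rfl fun b _ => by ring

theorem sum_stdSimplex_mul_le {ι : Type*} [Fintype ι] (p : stdSimplex ℝ ι) {f : ι → ℝ} {c : ℝ}
    (h : ∀ a, f a ≤ c) : ∑ a, p.1 a * f a ≤ c :=
  calc ∑ a, p.1 a * f a ≤ ∑ a, p.1 a * c :=
        Finset.sum_le_sum fun a _ => mul_le_mul_of_nonneg_left (h a) (p.2.1 a)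
    _ = c := by rw [← Finset.sum_mul, p.2.2, one_mul]

theorem abs_sum_stdSimplex_mul_le {ι : Type*} [Fintype ι] (p : stdSimplex ℝ ι) {f : ι → ℝ} {c : ℝ}
    (h : ∀ a, |f a| ≤ c) : |∑ a, p.1 a * f a| ≤ c := by
  refine abs_le.2 ⟨?_, sum_stdSimplex_mul_le p fun a => (abs_le.1 (h a)).2⟩
  have := sum_stdSimplex_mul_le p (f := fun a => - f a) (c := c)
    fun a => by linarith [(abs_le.1 (h a)).1]
  simp only [mul_neg, Finset.sum_neg_distrib] at this
  linarith

theorem exists_abs_le (w : S₁ → S₂ → ℝ) : ∃ C : ℝ, 0 ≤ C ∧ ∀ a b, |w a b| ≤ C := by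
  refine ⟨∑ p : S₁ × S₂, |w p.1 p.2|, Finset.sum_nonneg fun _ _ => abs_nonneg _, fun a b => ?_⟩
  exact Finset.single_le_sum (f := fun p : S₁ × S₂ => |w p.1 p.2|) (fun _ _ => abs_nonneg _)
    (Finset.mem_univ (a, b))

theorem continuous_expectedPayoff (w : S₁ → S₂ → ℝ) :
    Continuous fun σ : stdSimplex ℝ S₁ × stdSimplex ℝ S₂ => expectedPayoff w σ.1 σ.2 := by
  unfold expectedPayoff
  refine continuous_finsetSum _ fun a _ => continuous_finsetSum _ fun b _ => ?_
  have h1 : Continuous fun σ : stdSimplex ℝ S₁ × stdSimplex ℝ S₂ => σ.1.1 a :=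
    (continuous_apply a).comp (continuous_subtype_val.comp continuous_fst)
  have h2 : Continuous fun σ : stdSimplex ℝ S₁ × stdSimplex ℝ S₂ => σ.2.1 b :=
    (continuous_apply b).comp (continuous_subtype_val.comp continuous_snd)
  exact (h1.mul h2).mul continuous_const

variable [Nonempty S₁] [Nonempty S₂]

/-- Logit equilibria exist at every temperature and are approximate equilibria. -/
theorem Game.exists_approx_nash (G : Game S₁ S₂) {l : ℝ} (hl : 0 < l) :
    ∃ (σ₁ : stdSimplex ℝ S₁) (σ₂ : stdSimplex ℝ S₂),
      (∀ a, ∑ b, σ₂.1 b * G.u₁ a b ≤ expectedPayoff G.u₁ σ₁ σ₂ + Fintype.card S₁ / l) ∧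
      (∀ b, ∑ a, σ₁.1 a * G.u₂ a b ≤ expectedPayoff G.u₂ σ₁ σ₂ + Fintype.card S₂ / l) := by
  let s₁ : EuclideanSpace ℝ (S₁ ⊕ S₂) → S₁ → ℝ := fun x => softmax fun a => l * x (Sum.inl a)
  let s₂ : EuclideanSpace ℝ (S₁ ⊕ S₂) → S₂ → ℝ := fun x => softmax fun b => l * x (Sum.inr b)
  -- The iteration runs on vectors of pure-action payoffs rather than on strategies, so `h` is
  -- defined and bounded on a whole Euclidean space.
  let h : EuclideanSpace ℝ (S₁ ⊕ S₂) → EuclideanSpace ℝ (S₁ ⊕ S₂) := fun x =>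
    WithLp.toLp 2 (Sum.elim (fun a => ∑ b, s₂ x b * G.u₁ a b) (fun b => ∑ a, s₁ x a * G.u₂ a b))
  have hcoord : ∀ i : S₁ ⊕ S₂, ContDiff ℝ 1 fun x : EuclideanSpace ℝ (S₁ ⊕ S₂) => l * x i :=
    fun i => contDiff_const.mul (contDiff_euclidean.1 contDiff_id i)
  have hs₁ : ∀ a, ContDiff ℝ 1 fun x => s₁ x a := fun a =>
    (contDiff_softmax_apply a).comp (contDiff_pi.2 fun a => hcoord (Sum.inl a))
  have hs₂ : ∀ b, ContDiff ℝ 1 fun x => s₂ x b := fun b =>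
    (contDiff_softmax_apply b).comp (contDiff_pi.2 fun b => hcoord (Sum.inr b))
  have hh : ContDiff ℝ 1 h := by
    refine contDiff_euclidean.2 fun i => ?_
    rcases i with a | b
    · exact ContDiff.sum fun b _ => (hs₂ b).mul contDiff_const
    · exact ContDiff.sum fun a _ => (hs₁ a).mul contDiff_const
  have m₁ : ∀ x, s₁ x ∈ stdSimplex ℝ S₁ := fun x => softmax_mem_stdSimplex _
  have m₂ : ∀ x, s₂ x ∈ stdSimplex ℝ S₂ := fun x => softmax_mem_stdSimplex _
  obtain ⟨C₁, hC₁, hu₁⟩ := exists_abs_le G.u₁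
  obtain ⟨C₂, hC₂, hu₂⟩ := exists_abs_le G.u₂
  have hM : ∀ x, ‖h x‖ ≤ √(∑ _i : S₁ ⊕ S₂, (C₁ + C₂) ^ 2) := by
    intro x
    rw [EuclideanSpace.norm_eq]
    refine Real.sqrt_le_sqrt (Finset.sum_le_sum fun i _ => ?_)
    refine pow_le_pow_left₀ (norm_nonneg _) ?_ 2
    rw [Real.norm_eq_abs]
    rcases i with a | b
    · exact (abs_sum_stdSimplex_mul_le ⟨s₂ x, m₂ x⟩ fun b => hu₁ a b).trans (by linarith)
    · exact (abs_sum_stdSimplex_mul_le ⟨s₁ x, m₁ x⟩ fun a => hu₂ a b).trans (by linarith)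
  obtain ⟨x, hx⟩ := exists_fixedPoint_of_bounded hh hM
  have hxl : ∀ a, x (Sum.inl a) = ∑ b, s₂ x b * G.u₁ a b := fun a =>
    (congrArg (fun y : EuclideanSpace ℝ (S₁ ⊕ S₂) => y (Sum.inl a)) hx).symm
  have hxr : ∀ b, x (Sum.inr b) = ∑ a, s₁ x a * G.u₂ a b := fun b =>
    (congrArg (fun y : EuclideanSpace ℝ (S₁ ⊕ S₂) => y (Sum.inr b)) hx).symm
  refine ⟨⟨s₁ x, m₁ x⟩, ⟨s₂ x, m₂ x⟩, fun a => ?_, fun b => ?_⟩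
  · have := le_sum_softmax_mul (fun a => l * x (Sum.inl a)) a
    rw [expectedPayoff_eq_sum_left]
    simp only [← hxl]
    rw [← sub_le_iff_le_add', le_div_iff₀ hl]
    simp only [mul_left_comm _ l, ← Finset.mul_sum] at this
    linarith
  · have := le_sum_softmax_mul (fun b => l * x (Sum.inr b)) b
    rw [← expectedPayoff_swap, expectedPayoff_eq_sum_left]
    simp only [← hxr]
    rw [← sub_le_iff_le_add', le_div_iff₀ hl]
    simp only [mul_left_comm _ l, ← Finset.mul_sum] at this
    linarith

/-- Nash's theorem for two players. -/
theorem Game.exists_nash (G : Game S₁ S₂) :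
    ∃ (σ₁ : stdSimplex ℝ S₁) (σ₂ : stdSimplex ℝ S₂), G.IsNash σ₁ σ₂ := by
  choose σ₁ σ₂ h₁ h₂ using fun n : ℕ => G.exists_approx_nash (l := n + 1) (by positivity)
  have : CompactSpace (stdSimplex ℝ S₁) := isCompact_iff_compactSpace.1 (isCompact_stdSimplex ℝ S₁)
  have : CompactSpace (stdSimplex ℝ S₂) := isCompact_iff_compactSpace.1 (isCompact_stdSimplex ℝ S₂)
  obtain ⟨τ, φ, hφ, hlim⟩ := CompactSpace.tendsto_subseq fun n => (σ₁ n, σ₂ n)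
  have herr : ∀ c : ℝ, Tendsto (fun n => c / ((φ n : ℝ) + 1)) atTop (𝓝 0) := fun c =>
    (tendsto_const_nhds.div_atTop
      (tendsto_atTop_add_const_right _ 1 tendsto_natCast_atTop_atTop)).comp hφ.tendsto_atTop
  have hlim₁ : ∀ a, Tendsto (fun n => (σ₁ (φ n)).1 a) atTop (𝓝 (τ.1.1 a)) := fun a =>
    (((continuous_apply a).comp (continuous_subtype_val.comp continuous_fst)).tendsto τ).comp hlim
  have hlim₂ : ∀ b, Tendsto (fun n => (σ₂ (φ n)).1 b) atTop (𝓝 (τ.2.1 b)) := fun b =>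
    (((continuous_apply b).comp (continuous_subtype_val.comp continuous_snd)).tendsto τ).comp hlim
  refine ⟨τ.1, τ.2, fun σ' => ?_, fun σ' => ?_⟩
  · rw [expectedPayoff_eq_sum_left]
    refine sum_stdSimplex_mul_le σ' fun a => ?_
    have hr := (((continuous_expectedPayoff G.u₁).tendsto τ).comp hlim).add
      (herr (Fintype.card S₁))
    rw [add_zero] at hr
    exact le_of_tendsto_of_tendsto'
      (tendsto_finsetSum _ fun b _ => (hlim₂ b).mul_const (G.u₁ a b)) hr fun n => h₁ (φ n) a
  · rw [← expectedPayoff_swap, expectedPayoff_eq_sum_left]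
    refine sum_stdSimplex_mul_le σ' fun b => ?_
    have hr := (((continuous_expectedPayoff G.u₂).tendsto τ).comp hlim).add
      (herr (Fintype.card S₂))
    rw [add_zero] at hr
    exact le_of_tendsto_of_tendsto'
      (tendsto_finsetSum _ fun a _ => (hlim₁ a).mul_const (G.u₂ a b)) hr fun n => h₂ (φ n) b

end Nash

/-! ### Averages of eventually periodic sequences -/

section Averages

theorem sum_range_window_eq {f : ℕ → ℝ} {T k : ℕ} (hf : ∀ j, k ≤ j → f (j + T) = f j) (N : ℕ) :
    ∑ j ∈ Finset.range T, f (k + N + j) = ∑ j ∈ Finset.range T, f (k + j) := by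
  induction N with
  | zero => simp
  | succ N ih =>
    rw [← ih]
    have h1 := Finset.sum_range_succ (fun j => f (k + N + j)) T
    rw [Finset.sum_range_succ', add_zero, hf (k + N) (by omega)] at h1
    have h2 := add_right_cancel h1
    rw [← h2]
    exact Finset.sum_congr rfl fun j _ => by congr 1; omega

/-- The averages of an eventually periodic sequence converge to the mean over a period. -/
theorem tendsto_average_of_eventually_periodic {f : ℕ → ℝ} {T k : ℕ} (hT : 0 < T)
    (hf : ∀ j, k ≤ j → f (j + T) = f j) :
    Tendsto (fun N : ℕ => (1 / (N : ℝ)) * ∑ j ∈ Finset.range N, f j) atTop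
      (𝓝 ((1 / (T : ℝ)) * ∑ j ∈ Finset.range T, f (k + j))) := by
  have hT' : (T : ℝ) ≠ 0 := by positivity
  set A : ℝ := (1 / (T : ℝ)) * ∑ j ∈ Finset.range T, f (k + j) with hA
  -- The deviation from linear growth is itself eventually periodic, hence bounded.
  let D : ℕ → ℝ := fun N => ∑ j ∈ Finset.range N, f j - N * A
  have hper : ∀ N, k ≤ N → D (N + T) = D N := by
    intro N hN
    obtain ⟨M, rfl⟩ := Nat.exists_eq_add_of_le hN
    simp only [D]
    rw [Finset.sum_range_add, sum_range_window_eq hf M]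
    push_cast
    rw [hA]
    field_simp
    ring
  have hbound : ∀ N, |D N| ≤ ∑ i ∈ Finset.range (k + T), |D i| := by
    intro N
    induction N using Nat.strong_induction_on with
    | _ N ih =>
      rcases lt_or_ge N (k + T) with h | h
      · exact Finset.single_le_sum (f := fun i => |D i|) (fun _ _ => abs_nonneg _)
          (Finset.mem_range.2 h)
      · have := hper (N - T) (by omega)
        rw [Nat.sub_add_cancel (by omega)] at this
        rw [this]
        exact ih _ (by omega)
  have hD : Tendsto (fun N : ℕ => D N / (N : ℝ)) atTop (𝓝 0) := by
    refine squeeze_zero_norm (fun N => ?_)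
      (tendsto_const_div_atTop_nhds_zero_nat (∑ i ∈ Finset.range (k + T), |D i|))
    rw [norm_div, Real.norm_eq_abs, Real.norm_natCast]
    exact div_le_div_of_nonneg_right (hbound N) (Nat.cast_nonneg _)
  have := hD.const_add A
  rw [add_zero] at this
  refine this.congr' ?_
  filter_upwards [eventually_gt_atTop 0] with N hN
  have : (N : ℝ) ≠ 0 := by positivity
  simp only [D]
  field_simp
  ring

theorem sum_range_mul_eq {M : Type*} [AddCommMonoid M] (F : ℕ → M) (a b : ℕ) :
    ∑ j ∈ Finset.range (a * b), F j = ∑ i ∈ Finset.range b, ∑ x ∈ Finset.range a, F (x + a * i) := by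
  induction b with
  | zero => simp
  | succ b ih =>
    rw [Nat.mul_succ, Finset.sum_range_add, ih, Finset.sum_range_succ]
    simp only [add_comm]

theorem sum_range_coprime_progression {M : Type*} [AddCommMonoid M] (H : ℕ → M) {k m : ℕ}
    (hm : 0 < m) (hkm : Nat.Coprime k m) (c : ℕ) :
    ∑ i ∈ Finset.range m, H ((c + k * i) % m) = ∑ i ∈ Finset.range m, H i := by
  have hinj : Set.InjOn (fun i => (c + k * i) % m) (Finset.range m) := by
    intro i hi j hj hij
    have h1 : k * i ≡ k * j [MOD m] := Nat.ModEq.add_left_cancel' c hij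
    have h2 : i ≡ j [MOD m] := Nat.ModEq.cancel_left_of_coprime (by simpa [Nat.gcd_comm] using hkm) h1
    exact h2.eq_of_lt_of_lt (by simpa using hi) (by simpa using hj)
  have himg : (Finset.range m).image (fun i => (c + k * i) % m) = Finset.range m := by
    refine Finset.eq_of_subset_of_card_le ?_ ?_
    · intro y hy
      obtain ⟨i, _, rfl⟩ := Finset.mem_image.1 hy
      exact Finset.mem_range.2 (Nat.mod_lt _ hm)
    · rw [Finset.card_image_of_injOn hinj]
  conv_rhs => rw [← himg]
  rw [Finset.sum_image hinj]

theorem unfoldingPayoff_eq_of_tendsto {S₁ : Type*} {S₂ : Type*} {w : S₁ → S₂ → ℝ} {s₁ : ℕ → S₁}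
    {s₂ : ℕ → S₂} {x : ℝ}
    (h : Tendsto (fun N : ℕ => (1 / (N : ℝ)) * ∑ j ∈ Finset.range N, w (s₁ j) (s₂ j)) atTop (𝓝 x)) :
    unfoldingPayoff w s₁ s₂ = x :=
  h.liminf_eq

theorem periodic_mul {S : Type*} {s : ℕ → S} {k T : ℕ} (h : ∀ j, k ≤ j → s (j + T) = s j) (i : ℕ) :
    ∀ j, k ≤ j → s (j + T * i) = s j := by
  induction i with
  | zero => simp
  | succ i ih =>
    intro j hj
    rw [Nat.mul_succ, ← add_assoc, h _ (by omega), ih j hj]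

end Averages

/-! ### Spread-out blocks -/

section Spread

/-- The sequence that plays each entry of the block `g 0, …, g (m - 1)` for `d` consecutive rounds,
and then starts again. -/
def spread {S : Type*} (d m : ℕ) (g : ℕ → S) (j : ℕ) : S := g ((j / d) % m)

theorem spread_add {S : Type*} {d : ℕ} (hd : 0 < d) (m : ℕ) (g : ℕ → S) (j i : ℕ) :
    spread d m g (j + d * i) = g ((j / d + i) % m) := by
  simp only [spread]
  rw [Nat.add_mul_div_left _ _ hd]

theorem spread_mem_strategySpace {S : Type*} {d m : ℕ} (hd : 0 < d) (hm : 0 < m) (g : ℕ → S) :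
    spread d m g ∈ strategySpace S (d * m) := by
  refine ⟨by positivity, 0, fun j _ => ?_⟩
  rw [spread_add hd, Nat.add_mod_right]
  rfl

/-- Against a sequence whose period is a multiple `d * k` of `d` with `k` coprime to `m`, the
sequence `spread d m g` looks in every residue class modulo `d` like the uniform average over the
block `g`. -/
theorem tendsto_average_spread {S₁ S₂ : Type*} (w : S₁ → S₂ → ℝ) {s₁ : ℕ → S₁} {d k m k₀ : ℕ}
    (hd : 0 < d) (hk : 0 < k) (hm : 0 < m) (hkm : Nat.Coprime k m)
    (hs : ∀ j, k₀ ≤ j → s₁ (j + d * k) = s₁ j) (g : ℕ → S₂) :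
    Tendsto (fun N : ℕ => (1 / (N : ℝ)) * ∑ j ∈ Finset.range N, w (s₁ j) (spread d m g j)) atTop
      (𝓝 ((1 / ((d * k : ℕ) : ℝ)) * ∑ x ∈ Finset.range (d * k),
        (1 / (m : ℝ)) * ∑ l ∈ Finset.range m, w (s₁ (k₀ + x)) (g l))) := by
  have hper : ∀ j, k₀ ≤ j → w (s₁ (j + d * k * m)) (spread d m g (j + d * k * m))
      = w (s₁ j) (spread d m g j) := by
    intro j hj
    rw [periodic_mul hs m j hj, mul_assoc, spread_add hd, Nat.add_mul_mod_self_right]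
    rfl
  convert tendsto_average_of_eventually_periodic (f := fun j => w (s₁ j) (spread d m g j))
    (T := d * k * m) (k := k₀) (by positivity) hper using 2
  rw [sum_range_mul_eq _ (d * k) m, Finset.sum_comm]
  have hterm : ∀ x, ∑ i ∈ Finset.range m, w (s₁ (k₀ + (x + d * k * i)))
      (spread d m g (k₀ + (x + d * k * i))) = ∑ l ∈ Finset.range m, w (s₁ (k₀ + x)) (g l) := by
    intro x
    -- The indices `(k₀ + x) / d + k * i` run once through the residues modulo `m`.
    rw [← sum_range_coprime_progression (fun l => w (s₁ (k₀ + x)) (g l)) hm hkm ((k₀ + x) / d)]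
    refine Finset.sum_congr rfl fun i _ => ?_
    rw [← add_assoc, periodic_mul hs i _ (by omega), mul_assoc, spread_add hd]
  simp only [hterm, ← Finset.mul_sum]
  push_cast
  field_simp

end Spread

/-! ### Block frequencies and approximation of mixed strategies -/

section Frequencies

variable {S : Type*} [Fintype S]

open Classical in
/-- Frequencies of the actions in the block `s k, …, s (k + T - 1)`. -/
noncomputable def blockFreq (s : ℕ → S) (k T : ℕ) (a : S) : ℝ :=
  (1 / (T : ℝ)) * ∑ x ∈ Finset.range T, if s (k + x) = a then 1 else 0

theorem sum_blockFreq_mul (s : ℕ → S) (k T : ℕ) (φ : S → ℝ) :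
    ∑ a, blockFreq s k T a * φ a = (1 / (T : ℝ)) * ∑ x ∈ Finset.range T, φ (s (k + x)) := by
  classical
  simp only [blockFreq, mul_assoc, ← Finset.mul_sum, Finset.sum_mul]
  rw [Finset.sum_comm]
  simp

theorem blockFreq_mem_stdSimplex (s : ℕ → S) (k : ℕ) {T : ℕ} (hT : 0 < T) :
    blockFreq s k T ∈ stdSimplex ℝ S := by
  refine ⟨fun a => ?_, ?_⟩
  · exact mul_nonneg (by positivity) (Finset.sum_nonneg fun x _ => by split_ifs <;> norm_num)
  · have := sum_blockFreq_mul s k T fun _ => 1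
    have hT' : (T : ℝ) ≠ 0 := by positivity
    simpa [hT'] using this

theorem isFolding_spread {d m : ℕ} (hd : 0 < d) (hm : 0 < m) (g : ℕ → S) :
    IsFolding (spread d m g) ⟨blockFreq g 0 m, blockFreq_mem_stdSimplex g 0 hm⟩ := by
  classical
  intro a
  -- Frequencies are payoffs against an opponent with a single action.
  have h := tendsto_average_spread (fun (_ : Unit) b => if b = a then (1 : ℝ) else 0)
    (s₁ := fun _ => ()) (k₀ := 0) hd one_pos hm (Nat.coprime_one_left m) (fun _ _ => rfl) g
  simp only [Finset.sum_const, Finset.card_range, nsmul_eq_mul] at h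
  convert h using 2
  · rw [Finset.natCast_card_filter]
  · have : ((d * 1 : ℕ) : ℝ) ≠ 0 := by positivity
    simp only [blockFreq, zero_add]
    rw [← mul_assoc, one_div_mul_cancel this, one_mul]

/-- Every mixed strategy is realized by a block of length `m` up to an error of order `1 / m`. -/
theorem exists_block_approx [Nonempty S] (σ : stdSimplex ℝ S) {m : ℕ} (hm : 0 < m) :
    ∃ g : ℕ → S, ∀ a, |blockFreq g 0 m a - σ.1 a| ≤ Fintype.card S / m := by
  classical
  obtain ⟨a₀⟩ := ‹Nonempty S›
  have hm' : (0 : ℝ) < m := by positivity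
  let f : S → ℕ := fun a => ⌊(m : ℝ) * σ.1 a⌋₊
  have hf0 : ∀ a, (f a : ℝ) ≤ m * σ.1 a := fun a =>
    Nat.floor_le (mul_nonneg hm'.le (σ.2.1 a))
  have hf1 : ∀ a, (m : ℝ) * σ.1 a < f a + 1 := fun a => Nat.lt_floor_add_one _
  have hsum : ∑ a, (m : ℝ) * σ.1 a = m := by rw [← Finset.mul_sum, σ.2.2, mul_one]
  have hle : ∑ a, f a ≤ m := by
    have : ∑ a, (f a : ℝ) ≤ m := hsum ▸ Finset.sum_le_sum fun a _ => hf0 a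
    exact_mod_cast this
  have hge : (m : ℝ) ≤ ∑ a, (f a : ℝ) + Fintype.card S := by
    have := Finset.sum_le_sum fun a (_ : a ∈ Finset.univ) => (hf1 a).le
    rw [hsum, Finset.sum_add_distrib] at this
    simpa using this
  -- Rounding down leaves at most `Fintype.card S` places, all given to `a₀`.
  let c : S → ℕ := fun a => f a + if a = a₀ then m - ∑ a, f a else 0
  have hc : ∑ a, c a = m := by
    simp only [c, Finset.sum_add_distrib, Finset.sum_ite_eq', Finset.mem_univ, if_true]
    omega
  let e : Fin m ≃ Σ a, Fin (c a) := Fintype.equivOfCardEq (by simp [hc])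
  let g : ℕ → S := fun i => if h : i < m then (e ⟨i, h⟩).1 else a₀
  have hcount : ∀ a, blockFreq g 0 m a = c a / m := by
    intro a
    have h1 : ∑ x ∈ Finset.range m, (if g (0 + x) = a then (1 : ℝ) else 0) = c a := by
      rw [Finset.sum_range]
      have : ∀ i : Fin m, g (0 + i) = (e i).1 := fun i => by simp [g]
      simp only [this]
      rw [e.sum_comp fun p => if p.1 = a then (1 : ℝ) else 0, Fintype.sum_sigma]
      rw [Finset.sum_eq_single a (fun b _ hb => by simp [hb]) (by simp)]
      simp
    simp only [blockFreq]
    rw [one_div_mul_eq_div]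
    congr 1
  refine ⟨g, fun a => ?_⟩
  have hcard : (1 : ℝ) ≤ Fintype.card S := by
    exact_mod_cast Fintype.card_pos_iff.2 ⟨a₀⟩
  rw [hcount, show (c a : ℝ) / m - σ.1 a = (c a - m * σ.1 a) / m by field_simp, abs_div,
    abs_of_pos hm']
  refine div_le_div_of_nonneg_right ?_ hm'.le
  have h0 := hf0 a
  have h1 := hf1 a
  rw [abs_le]
  by_cases ha : a = a₀
  · have : (c a : ℝ) = f a + (m - ∑ a, (f a : ℝ)) := by
      simp only [c, ha, if_true]
      push_cast [Nat.cast_sub hle]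
      ring
    have hle' : ∑ a, (f a : ℝ) ≤ m := by exact_mod_cast hle
    rw [this]
    constructor <;> linarith
  · have : (c a : ℝ) = f a := by simp [c, ha]
    rw [this]
    constructor <;> linarith

end Frequencies

/-! ### Realizing Nash equilibria -/

section Realization

variable {S₁ : Type u} {S₂ : Type v} [Fintype S₁] [Fintype S₂]

theorem expectedPayoff_blockFreq_left (w : S₁ → S₂ → ℝ) (s : ℕ → S₁) (k : ℕ) {T : ℕ} (hT : 0 < T)
    (p : stdSimplex ℝ S₂) :
    expectedPayoff w ⟨blockFreq s k T, blockFreq_mem_stdSimplex s k hT⟩ p =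
      (1 / (T : ℝ)) * ∑ x ∈ Finset.range T, ∑ b, p.1 b * w (s (k + x)) b := by
  rw [expectedPayoff_eq_sum_left, sum_blockFreq_mul s k T fun a => ∑ b, p.1 b * w a b]

theorem unfoldingPayoff_spread (w : S₁ → S₂ → ℝ) {s₁ : ℕ → S₁} {d k m k₀ : ℕ}
    (hd : 0 < d) (hk : 0 < k) (hm : 0 < m) (hkm : Nat.Coprime k m)
    (hs : ∀ j, k₀ ≤ j → s₁ (j + d * k) = s₁ j) (g : ℕ → S₂) :
    unfoldingPayoff w s₁ (spread d m g) =
      expectedPayoff w ⟨blockFreq s₁ k₀ (d * k), blockFreq_mem_stdSimplex s₁ k₀ (by positivity)⟩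
        ⟨blockFreq g 0 m, blockFreq_mem_stdSimplex g 0 hm⟩ := by
  rw [unfoldingPayoff_eq_of_tendsto (tendsto_average_spread w hd hk hm hkm hs g),
    expectedPayoff_blockFreq_left _ _ _ (by positivity)]
  simp only [sum_blockFreq_mul, zero_add]

theorem unfoldingPayoff_spread_spread (w : S₁ → S₂ → ℝ) {d k m : ℕ}
    (hd : 0 < d) (hk : 0 < k) (hm : 0 < m) (hkm : Nat.Coprime k m) (f : ℕ → S₁) (g : ℕ → S₂) :
    unfoldingPayoff w (spread d k f) (spread d m g) =
      expectedPayoff w ⟨blockFreq f 0 k, blockFreq_mem_stdSimplex f 0 hk⟩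
        ⟨blockFreq g 0 m, blockFreq_mem_stdSimplex g 0 hm⟩ := by
  have hper : ∀ j, 0 ≤ j → spread d k f (j + d * k) = spread d k f j := fun j _ => by
    rw [spread_add hd, Nat.add_mod_right]; rfl
  classical
  rw [unfoldingPayoff_spread w hd hk hm hkm hper g]
  congr 2
  funext a
  -- Both frequency vectors are limits of the same averages along `spread d k f`.
  have h1 := isFolding_spread hd hk f a
  have h2 := tendsto_average_of_eventually_periodic
    (f := fun j => if spread d k f j = a then (1 : ℝ) else 0) (T := d * k) (k := 0) (by positivity)
    (fun j hj => by rw [hper j hj])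
  simp only [Finset.natCast_card_filter] at h1
  convert tendsto_nhds_unique h2 ((h1.congr fun N => ?_)) using 1
  · simp only [blockFreq]
  · congr!

theorem expectedPayoff_sub_le {w : S₁ → S₂ → ℝ} {C : ℝ} (hC : ∀ a b, |w a b| ≤ C)
    (f : stdSimplex ℝ S₁) (p q : stdSimplex ℝ S₂) :
    expectedPayoff w f p - expectedPayoff w f q ≤ C * ∑ b, |p.1 b - q.1 b| := by
  rw [expectedPayoff_eq_sum_left, expectedPayoff_eq_sum_left, ← Finset.sum_sub_distrib]
  simp only [← mul_sub, ← Finset.sum_sub_distrib, ← sub_mul]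
  refine sum_stdSimplex_mul_le f fun a => ?_
  rw [Finset.mul_sum]
  refine Finset.sum_le_sum fun b _ => ?_
  calc (p.1 b - q.1 b) * w a b ≤ |(p.1 b - q.1 b) * w a b| := le_abs_self _
    _ = |w a b| * |p.1 b - q.1 b| := by rw [abs_mul, mul_comm]
    _ ≤ C * |p.1 b - q.1 b| := mul_le_mul_of_nonneg_right (hC a b) (abs_nonneg _)

/-- A player facing a spread-out block cannot do better than against the mixed strategy `σ₂` which
the block approximates, up to the error of the approximation. -/
theorem unfoldingPayoff_spread_le {w : S₁ → S₂ → ℝ} {C : ℝ} (hC : ∀ a b, |w a b| ≤ C)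
    {σ₁ : stdSimplex ℝ S₁} {σ₂ : stdSimplex ℝ S₂}
    (hσ : ∀ σ₁', expectedPayoff w σ₁' σ₂ ≤ expectedPayoff w σ₁ σ₂) {s₁ : ℕ → S₁} {d k m : ℕ}
    (hd : 0 < d) (hk : 0 < k) (hm : 0 < m) (hkm : Nat.Coprime k m)
    (hs : s₁ ∈ strategySpace S₁ (d * k)) (g : ℕ → S₂) :
    unfoldingPayoff w s₁ (spread d m g) ≤
      expectedPayoff w σ₁ σ₂ + C * ∑ b, |blockFreq g 0 m b - σ₂.1 b| := by
  obtain ⟨_, k₀, hk₀⟩ := hs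
  rw [unfoldingPayoff_spread w hd hk hm hkm hk₀ g]
  have h1 := expectedPayoff_sub_le hC
    ⟨blockFreq s₁ k₀ (d * k), blockFreq_mem_stdSimplex s₁ k₀ (by positivity)⟩
    ⟨blockFreq g 0 m, blockFreq_mem_stdSimplex g 0 hm⟩ σ₂
  have h2 := hσ ⟨blockFreq s₁ k₀ (d * k), blockFreq_mem_stdSimplex s₁ k₀ (by positivity)⟩
  simp only at h1
  linarith

theorem exists_blocks_tendsto [Nonempty S₁] (σ : stdSimplex ℝ S₁) {m : ℕ → ℕ} (hm : ∀ n, 0 < m n)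
    (hlim : Tendsto (fun n => 1 / (m n : ℝ)) atTop (𝓝 0)) :
    ∃ g : ℕ → ℕ → S₁, ∀ a, Tendsto (fun n => blockFreq (g n) 0 (m n) a) atTop (𝓝 (σ.1 a)) := by
  choose g hg using fun n => exists_block_approx σ (hm n)
  refine ⟨g, fun a => ?_⟩
  rw [tendsto_iff_norm_sub_tendsto_zero]
  refine squeeze_zero (fun _ => norm_nonneg _) (fun n => hg n a) ?_
  have := hlim.const_mul (Fintype.card S₁ : ℝ)
  simpa [div_eq_mul_inv] using this

theorem tendsto_sum_abs_sub {ι : Type*} [Fintype ι] {μ : ℕ → ι → ℝ} {σ : ι → ℝ}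
    (h : ∀ a, Tendsto (fun n => μ n a) atTop (𝓝 (σ a))) :
    Tendsto (fun n => ∑ a, |μ n a - σ a|) atTop (𝓝 0) := by
  have := tendsto_finsetSum (Finset.univ : Finset ι) fun a _ => ((h a).sub_const (σ a)).abs
  simpa using this

/-- After dividing out the gcd, the ratios in `AlmostCoprime` are `1 / k` and `1 / m`. -/
theorem AlmostCoprime.exists_factors {τ₁ τ₂ : ℕ → ℕ} (hτ₁ : ∀ n, 0 < τ₁ n) (hτ₂ : ∀ n, 0 < τ₂ n)
    (hco : AlmostCoprime τ₁ τ₂) :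
    ∃ d k m : ℕ → ℕ, (∀ n, 0 < d n) ∧ (∀ n, 0 < k n) ∧ (∀ n, 0 < m n) ∧
      (∀ n, τ₁ n = d n * k n) ∧ (∀ n, τ₂ n = d n * m n) ∧ (∀ n, Nat.Coprime (k n) (m n)) ∧
      Tendsto (fun n => 1 / (k n : ℝ)) atTop (𝓝 0) ∧
      Tendsto (fun n => 1 / (m n : ℝ)) atTop (𝓝 0) := by
  obtain ⟨d, hdef⟩ : ∃ d : ℕ → ℕ, ∀ n, Nat.gcd (τ₁ n) (τ₂ n) = d n := ⟨_, fun _ => rfl⟩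
  simp only [AlmostCoprime, hdef] at hco
  have hd : ∀ n, 0 < d n := fun n => hdef n ▸ Nat.gcd_pos_of_pos_left _ (hτ₁ n)
  choose k hk using fun n => hdef n ▸ Nat.gcd_dvd_left (τ₁ n) (τ₂ n)
  choose m hm using fun n => hdef n ▸ Nat.gcd_dvd_right (τ₁ n) (τ₂ n)
  have hk0 : ∀ n, 0 < k n := fun n => Nat.pos_of_mul_pos_left ((hk n) ▸ hτ₁ n)
  have hm0 : ∀ n, 0 < m n := fun n => Nat.pos_of_mul_pos_left ((hm n) ▸ hτ₂ n)
  have hkm : ∀ n, Nat.Coprime (k n) (m n) := fun n => by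
    have h := hdef n
    rw [hk n, hm n, Nat.gcd_mul_left] at h
    exact Nat.eq_of_mul_eq_mul_left (hd n) (by rw [h, mul_one])
  have hd' : ∀ n, (d n : ℝ) ≠ 0 := fun n => Nat.cast_ne_zero.2 (hd n).ne'
  have hklim : Tendsto (fun n => 1 / (k n : ℝ)) atTop (𝓝 0) := by
    refine hco.1.congr fun n => ?_
    rw [hk n, Nat.cast_mul, ← div_div, div_self (hd' n)]
  have hmlim : Tendsto (fun n => 1 / (m n : ℝ)) atTop (𝓝 0) := by
    refine hco.2.congr fun n => ?_
    rw [hm n, Nat.cast_mul, ← div_div, div_self (hd' n)]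
  exact ⟨d, k, m, hd, hk0, hm0, hk, hm, hkm, hklim, hmlim⟩

/-- Every Nash equilibrium is realized in the unfolding when the levels are almost coprime. -/
theorem Game.isRealizedInUnfolding [Nonempty S₁] [Nonempty S₂] (G : Game S₁ S₂) {τ₁ τ₂ : ℕ → ℕ}
    (hτ₁ : ∀ n, 0 < τ₁ n) (hτ₂ : ∀ n, 0 < τ₂ n) (hco : AlmostCoprime τ₁ τ₂)
    {σ₁ : stdSimplex ℝ S₁} {σ₂ : stdSimplex ℝ S₂} (hσ : G.IsNash σ₁ σ₂) :
    G.IsRealizedInUnfolding τ₁ τ₂ σ₁ σ₂ := by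
  obtain ⟨d, k, m, hd, hk0, hm0, hk, hm, hkm, hklim, hmlim⟩ := hco.exists_factors hτ₁ hτ₂
  obtain ⟨f, hf⟩ := exists_blocks_tendsto σ₁ hk0 hklim
  obtain ⟨g, hg⟩ := exists_blocks_tendsto σ₂ hm0 hmlim
  let μ₁ : ℕ → stdSimplex ℝ S₁ := fun n => ⟨_, blockFreq_mem_stdSimplex (f n) 0 (hk0 n)⟩
  let μ₂ : ℕ → stdSimplex ℝ S₂ := fun n => ⟨_, blockFreq_mem_stdSimplex (g n) 0 (hm0 n)⟩
  have hμ : Tendsto (fun n => (μ₁ n, μ₂ n)) atTop (𝓝 (σ₁, σ₂)) :=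
    (tendsto_subtype_rng.2 (tendsto_pi_nhds.2 hf)).prodMk_nhds
      (tendsto_subtype_rng.2 (tendsto_pi_nhds.2 hg))
  have hpay : ∀ (w : S₁ → S₂ → ℝ) n,
      unfoldingPayoff w (spread (d n) (k n) (f n)) (spread (d n) (m n) (g n)) =
        expectedPayoff w (μ₁ n) (μ₂ n) := fun w n =>
    unfoldingPayoff_spread_spread w (hd n) (hk0 n) (hm0 n) (hkm n) (f n) (g n)
  have hpaylim : ∀ w : S₁ → S₂ → ℝ, Tendsto (fun n => unfoldingPayoff w
      (spread (d n) (k n) (f n)) (spread (d n) (m n) (g n))) atTop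
      (𝓝 (expectedPayoff w σ₁ σ₂)) := by
    intro w
    have := ((continuous_expectedPayoff w).tendsto (σ₁, σ₂)).comp hμ
    exact this.congr fun n => (hpay w n).symm
  obtain ⟨C₁, -, hC₁⟩ := exists_abs_le G.u₁
  obtain ⟨C₂, -, hC₂⟩ := exists_abs_le G.u₂
  refine ⟨fun n => spread (d n) (k n) (f n), fun n => spread (d n) (m n) (g n), ?_,
    ⟨μ₁, fun n => isFolding_spread (hd n) (hk0 n) (f n), hf⟩,
    ⟨μ₂, fun n => isFolding_spread (hd n) (hm0 n) (g n), hg⟩, hpaylim _, hpaylim _⟩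
  let ε₁ : ℕ → ℝ := fun n => expectedPayoff G.u₁ σ₁ σ₂ + C₁ * ∑ b, |(μ₂ n).1 b - σ₂.1 b| -
    unfoldingPayoff G.u₁ (spread (d n) (k n) (f n)) (spread (d n) (m n) (g n))
  let ε₂ : ℕ → ℝ := fun n => expectedPayoff G.u₂ σ₁ σ₂ + C₂ * ∑ a, |(μ₁ n).1 a - σ₁.1 a| -
    unfoldingPayoff G.u₂ (spread (d n) (k n) (f n)) (spread (d n) (m n) (g n))
  have hε₁ : Tendsto ε₁ atTop (𝓝 0) := by
    simpa using (((tendsto_sum_abs_sub hg).const_mul C₁).const_add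
      (expectedPayoff G.u₁ σ₁ σ₂)).sub (hpaylim G.u₁)
  have hε₂ : Tendsto ε₂ atTop (𝓝 0) := by
    simpa using (((tendsto_sum_abs_sub hf).const_mul C₂).const_add
      (expectedPayoff G.u₂ σ₁ σ₂)).sub (hpaylim G.u₂)
  refine ⟨fun n => max (ε₁ n) (ε₂ n), by simpa using hε₁.max hε₂, fun n => ⟨?_, ?_, ?_, ?_⟩⟩
  · rw [hk n]; exact spread_mem_strategySpace (hd n) (hk0 n) (f n)
  · rw [hm n]; exact spread_mem_strategySpace (hd n) (hm0 n) (g n)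
  · intro s hs
    rw [hk n] at hs
    refine le_trans (sub_le_sub_right ?_ _) (le_max_left (ε₁ n) (ε₂ n))
    exact unfoldingPayoff_spread_le hC₁ hσ.1 (hd n) (hk0 n) (hm0 n) (hkm n) hs (g n)
  · intro s hs
    rw [hm n] at hs
    refine le_trans (sub_le_sub_right ?_ _) (le_max_right (ε₁ n) (ε₂ n))
    have := unfoldingPayoff_spread_le (w := fun b a => G.u₂ a b) (fun b a => hC₂ a b)
      (σ₁ := σ₂) (σ₂ := σ₁)
      (fun σ' => (expectedPayoff_swap G.u₂ σ₁ σ').trans_le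
        ((hσ.2 σ').trans_eq (expectedPayoff_swap G.u₂ σ₁ σ₂).symm))
      (hd n) (hm0 n) (hk0 n) (hkm n).symm hs (f n)
    rw [expectedPayoff_swap] at this
    exact this

end Realization

/-! ### Necessity of almost coprimeness -/

section MatchingPennies

/-- A biased matching pennies game in which the only optimal strategy of player 1 plays `true` with
probability `p`. -/
noncomputable def biasedPennies (p : ℝ) : Game (ULift.{u} Bool) (ULift.{v} Bool) where
  u₁ a b := (if b.down then 1 else -1) * ((if a.down then 1 else 0) - p)
  u₂ a b := -((if b.down then 1 else -1) * ((if a.down then 1 else 0) - p))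

/-- A genuine limit, unlike a `liminf`, is compatible with negation, so the unfolding of a zero-sum
game stays zero-sum. -/
theorem tendsto_average_of_mem_strategySpace {S₁ : Type u} {S₂ : Type v} (w : S₁ → S₂ → ℝ)
    {τ₁ τ₂ : ℕ} {s₁ : ℕ → S₁} {s₂ : ℕ → S₂} (h₁ : s₁ ∈ strategySpace S₁ τ₁)
    (h₂ : s₂ ∈ strategySpace S₂ τ₂) :
    ∃ x, Tendsto (fun N : ℕ => (1 / (N : ℝ)) * ∑ j ∈ Finset.range N, w (s₁ j) (s₂ j)) atTop
      (𝓝 x) := by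
  obtain ⟨ht₁, k₁, hk₁⟩ := h₁
  obtain ⟨ht₂, k₂, hk₂⟩ := h₂
  refine ⟨_, tendsto_average_of_eventually_periodic (f := fun j => w (s₁ j) (s₂ j))
    (T := τ₁ * τ₂) (k := max k₁ k₂) (by positivity) fun j hj => ?_⟩
  rw [periodic_mul hk₁ τ₂ j (le_trans (le_max_left _ _) hj), mul_comm τ₁ τ₂,
    periodic_mul hk₂ τ₁ j (le_trans (le_max_right _ _) hj)]

theorem const_mem_strategySpace {S : Type*} {τ : ℕ} (hτ : 0 < τ) (a : S) :
    (fun _ => a) ∈ strategySpace S τ :=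
  ⟨hτ, 0, fun _ _ => rfl⟩

/-- Player 1 can secure `0` in the unfolding of biased matching pennies with a constant sequence. -/
theorem exists_const_biasedPennies_nonneg {p : ℝ} (hp0 : 0 ≤ p) (hp1 : p ≤ 1) {τ₂ : ℕ}
    {s₂ : ℕ → ULift.{v} Bool} (h₂ : s₂ ∈ strategySpace (ULift.{v} Bool) τ₂) :
    ∃ a : ULift.{u} Bool, 0 ≤ unfoldingPayoff (biasedPennies p).u₁ (fun _ => a) s₂ := by
  obtain ⟨x, hx⟩ := tendsto_average_of_mem_strategySpace
    (fun (_ : ULift.{u} Bool) (b : ULift.{v} Bool) => if b.down then (1 : ℝ) else -1)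
    (const_mem_strategySpace one_pos ⟨true⟩) h₂
  have key : ∀ a : ULift.{u} Bool, unfoldingPayoff (biasedPennies p).u₁ (fun _ => a) s₂ =
      x * ((if a.down then 1 else 0) - p) := fun a => by
    refine unfoldingPayoff_eq_of_tendsto ((hx.mul_const _).congr fun N => ?_)
    simp only [biasedPennies]
    rw [← Finset.sum_mul, mul_assoc]
  rcases le_total 0 x with h | h
  · refine ⟨⟨true⟩, ?_⟩
    rw [key]
    simpa using mul_nonneg h (sub_nonneg.2 hp1)
  · refine ⟨⟨false⟩, ?_⟩
    rw [key]
    simpa using mul_nonpos_of_nonpos_of_nonneg h hp0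

/-- A number of the form `i / k` with `k < K` stays away from `1 / K`. -/
theorem one_div_le_abs_sub_div {n k K : ℕ} (hk : 0 < k) (hkK : k < K) :
    1 / (K : ℝ) ≤ |(n : ℝ) - k / K| := by
  have hK : (0 : ℝ) < K := by exact_mod_cast hk.trans hkK
  have hne : (n : ℤ) * K - k ≠ 0 := by
    intro h
    have h' : k = n * K := by zify; linarith
    rcases Nat.eq_zero_or_pos n with rfl | hn
    · omega
    · nlinarith
  have h1 : (1 : ℝ) ≤ |(n : ℝ) * K - k| := by exact_mod_cast Int.one_le_abs hne
  rw [show (n : ℝ) - k / K = (n * K - k) / K by field_simp, abs_div, abs_of_pos hK]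
  exact div_le_div_of_nonneg_right h1 hK.le

/-- When the period `d * k` of player 1 has `k < K`, a player 2 who can play `d`-periodic sequences
gains by exploiting player 1 in every residue class modulo `d`. -/
theorem exists_biasedPennies_exploit {d k K τ₂ : ℕ} (hd : 0 < d) (hk : 0 < k) (hkK : k < K)
    (hτ₂ : 0 < τ₂) (hdτ₂ : d ∣ τ₂) {s₁ : ℕ → ULift.{u} Bool}
    (h₁ : s₁ ∈ strategySpace (ULift.{u} Bool) (d * k)) :
    ∃ s₂ ∈ strategySpace (ULift.{v} Bool) τ₂,
      1 / (K : ℝ) ^ 2 ≤ unfoldingPayoff (biasedPennies (1 / (K : ℝ))).u₂ s₁ s₂ := by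
  obtain ⟨-, k₁, hk₁⟩ := h₁
  -- Starting at a multiple of `d` makes the offset `x` the residue modulo `d`.
  have hk₀ : ∀ j, d * k₁ ≤ j → s₁ (j + d * k) = s₁ j := fun j hj =>
    hk₁ j (le_trans (Nat.le_mul_of_pos_left _ hd) hj)
  let D : ℕ → ℝ := fun x => ∑ i ∈ Finset.range k,
    ((if (s₁ (d * k₁ + (x + d * i))).down then 1 else 0) - 1 / (K : ℝ))
  have hD : ∀ x, 1 / (K : ℝ) ≤ |D x| := fun x => by
    simp only [D, Finset.sum_sub_distrib, ← Finset.natCast_card_filter, Finset.sum_const,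
      Finset.card_range, nsmul_eq_mul, mul_one_div]
    exact one_div_le_abs_sub_div hk hkK
  -- The sign is chosen so that each residue class contributes `|D x|` per period.
  let s₂ : ℕ → ULift.{v} Bool := fun j => ⟨decide (D (j % d) < 0)⟩
  obtain ⟨e, rfl⟩ := hdτ₂
  have hper : ∀ j, s₂ (j + d) = s₂ j := fun j => by simp [s₂]
  refine ⟨s₂, ⟨hτ₂, 0, periodic_mul (fun j _ => hper j) e⟩, ?_⟩
  rw [unfoldingPayoff_eq_of_tendsto (tendsto_average_of_eventually_periodic
    (f := fun j => (biasedPennies (1 / (K : ℝ))).u₂ (s₁ j) (s₂ j)) (T := d * k) (k := d * k₁)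
    (by positivity) fun j hj => by
      rw [hk₀ j hj, periodic_mul (fun j _ => hper j) k j (Nat.zero_le j)]),
    sum_range_mul_eq _ d k, Finset.sum_comm]
  have hterm : ∀ x ∈ Finset.range d, 1 / (K : ℝ) ≤ ∑ i ∈ Finset.range k,
      (biasedPennies (1 / (K : ℝ))).u₂ (s₁ (d * k₁ + (x + d * i))) (s₂ (d * k₁ + (x + d * i))) := by
    intro x hx
    have hs : ∀ i, s₂ (d * k₁ + (x + d * i)) = ⟨decide (D x < 0)⟩ := fun i => by
      simp only [s₂]
      rw [Nat.mul_add_mod, Nat.add_mul_mod_self_left, Nat.mod_eq_of_lt (Finset.mem_range.1 hx)]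
    have hsum : ∑ i ∈ Finset.range k, (biasedPennies (1 / (K : ℝ))).u₂
        (s₁ (d * k₁ + (x + d * i))) (s₂ (d * k₁ + (x + d * i))) = |D x| := by
      simp only [hs, biasedPennies]
      rw [Finset.sum_neg_distrib, ← Finset.mul_sum]
      change -(_ * D x) = _
      rcases lt_or_ge (D x) 0 with h | h
      · simp [h, abs_of_neg h]
      · simp [not_lt.2 h, abs_of_nonneg h]
    rw [hsum]
    exact hD x
  have hsum := Finset.sum_le_sum hterm
  rw [Finset.sum_const, Finset.card_range, nsmul_eq_mul] at hsum
  have hK0 : (0 : ℝ) < K := by exact_mod_cast hk.trans hkK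
  have hkK' : (k : ℝ) ≤ K := by exact_mod_cast hkK.le
  have hk0 : (0 : ℝ) < k := by exact_mod_cast hk
  have hd0 : (0 : ℝ) < d := by exact_mod_cast hd
  -- A period has `d * k` rounds and `d` classes, each worth at least `1 / K`.
  calc 1 / (K : ℝ) ^ 2 ≤ 1 / (k * K) := by
        refine one_div_le_one_div_of_le (by positivity) ?_
        nlinarith
    _ = 1 / ((d * k : ℕ) : ℝ) * (d * (1 / (K : ℝ))) := by push_cast; field_simp
    _ ≤ _ := mul_le_mul_of_nonneg_left hsum (by positivity)

/-- If player 1 gets `x`, player 2 gets `-x`. Deviating can gain player 1 at least `-x` and player 2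
at least `1 / K ^ 2 + x`; adding the two bounds eliminates `x`. -/
theorem biasedPennies_epsNash_bound {τ₁ τ₂ K : ℕ} (hτ₁ : 0 < τ₁) (hτ₂ : 0 < τ₂) (hK : 0 < K)
    (hlt : τ₁ < K * Nat.gcd τ₁ τ₂) {ε : ℝ} {s₁ : ℕ → ULift.{u} Bool} {s₂ : ℕ → ULift.{v} Bool}
    (h : (biasedPennies (1 / (K : ℝ))).IsEpsNash τ₁ τ₂ ε s₁ s₂) : 1 / (K : ℝ) ^ 2 ≤ 2 * ε := by
  obtain ⟨h₁, h₂, hdev₁, hdev₂⟩ := h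
  have hd := Nat.gcd_pos_of_pos_left τ₂ hτ₁
  have hdτ₂ := Nat.gcd_dvd_right τ₁ τ₂
  obtain ⟨k, hk⟩ := Nat.gcd_dvd_left τ₁ τ₂
  generalize Nat.gcd τ₁ τ₂ = d at *
  subst hk
  have hk0 : 0 < k := Nat.pos_of_mul_pos_left hτ₁
  have hkK : k < K := by
    rw [mul_comm K d] at hlt
    exact lt_of_mul_lt_mul_left hlt (Nat.zero_le d)
  obtain ⟨t₂, ht₂, hpay₂⟩ := exists_biasedPennies_exploit.{u, v} hd hk0 hkK hτ₂ hdτ₂ h₁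
  have hK1 : (1 : ℝ) ≤ K := by exact_mod_cast hK
  obtain ⟨a, ha⟩ := exists_const_biasedPennies_nonneg.{u, v} (p := 1 / (K : ℝ)) (by positivity)
    (by rw [div_le_one (by positivity)]; exact hK1) h₂
  obtain ⟨x, hx⟩ := tendsto_average_of_mem_strategySpace
    (biasedPennies (1 / (K : ℝ))).u₁ h₁ h₂
  have hx₁ := unfoldingPayoff_eq_of_tendsto hx
  have hx₂ : unfoldingPayoff (biasedPennies (1 / (K : ℝ))).u₂ s₁ s₂ = -x := by
    refine unfoldingPayoff_eq_of_tendsto (hx.neg.congr fun N => ?_)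
    simp only [biasedPennies, Finset.sum_neg_distrib, mul_neg]
  have e₁ := hdev₁ _ (const_mem_strategySpace hτ₁ a)
  have e₂ := hdev₂ t₂ ht₂
  linarith

theorem tendsto_gcd_div_of_exists_nash {τ₁ τ₂ : ℕ → ℕ} (hτ₁ : ∀ n, 0 < τ₁ n) (hτ₂ : ∀ n, 0 < τ₂ n)
    (H : ∀ G : Game (ULift.{u} Bool) (ULift.{v} Bool),
      ∃ s₁ s₂, G.IsAlmostRationalNash τ₁ τ₂ s₁ s₂) :
    Tendsto (fun n => (Nat.gcd (τ₁ n) (τ₂ n) : ℝ) / (τ₁ n : ℝ)) atTop (𝓝 0) := by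
  rw [tendsto_order]
  refine ⟨fun a ha => Eventually.of_forall fun n => lt_of_lt_of_le ha (by positivity),
    fun δ hδ => ?_⟩
  -- With `K > 1 / δ`, a ratio of at least `δ` forces `τ₁ n` below `K` times the gcd.
  obtain ⟨K, hK⟩ := exists_nat_gt (1 / δ)
  have hK0 : (0 : ℝ) < K := (by positivity : (0 : ℝ) < 1 / δ).trans hK
  obtain ⟨s₁, s₂, ε, hε, hN⟩ := H (biasedPennies (1 / (K : ℝ)))
  have hε' : ∀ᶠ n in atTop, 2 * ε n < 1 / (K : ℝ) ^ 2 :=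
    (hε.const_mul 2).eventually (gt_mem_nhds (by rw [mul_zero]; positivity))
  filter_upwards [hε'] with n hn
  by_contra! hge
  refine absurd (biasedPennies_epsNash_bound (hτ₁ n) (hτ₂ n) (by exact_mod_cast hK0) ?_ (hN n))
    (not_le.2 hn)
  have hτ : (0 : ℝ) < τ₁ n := by exact_mod_cast hτ₁ n
  rw [le_div_iff₀ hτ] at hge
  rw [div_lt_iff₀ hδ] at hK
  have : (τ₁ n : ℝ) < K * Nat.gcd (τ₁ n) (τ₂ n) :=
    calc (τ₁ n : ℝ) = 1 * τ₁ n := (one_mul _).symm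
      _ < K * δ * τ₁ n := mul_lt_mul_of_pos_right hK hτ
      _ = K * (δ * τ₁ n) := mul_assoc _ _ _
      _ ≤ K * Nat.gcd (τ₁ n) (τ₂ n) := mul_le_mul_of_nonneg_left hge hK0.le
  exact_mod_cast this

/-- The game with the names of the two players exchanged. -/
def Game.swap {S₁ : Type u} {S₂ : Type v} (G : Game S₁ S₂) : Game S₂ S₁ where
  u₁ b a := G.u₂ a b
  u₂ b a := G.u₁ a b

theorem Game.IsAlmostRationalNash.swap {S₁ : Type u} {S₂ : Type v} {G : Game S₁ S₂} {τ₁ τ₂ : ℕ → ℕ}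
    {s₁ : ℕ → ℕ → S₁} {s₂ : ℕ → ℕ → S₂} (h : G.IsAlmostRationalNash τ₁ τ₂ s₁ s₂) :
    G.swap.IsAlmostRationalNash τ₂ τ₁ s₂ s₁ := by
  obtain ⟨ε, hε, hN⟩ := h
  exact ⟨ε, hε, fun n => ⟨(hN n).2.1, (hN n).1, (hN n).2.2.2, (hN n).2.2.1⟩⟩

theorem almostCoprime_of_exists_nash {τ₁ τ₂ : ℕ → ℕ} (hτ₁ : ∀ n, 0 < τ₁ n) (hτ₂ : ∀ n, 0 < τ₂ n)
    (H : ∀ G : Game (ULift.{u} Bool) (ULift.{v} Bool),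
      ∃ s₁ s₂, G.IsAlmostRationalNash τ₁ τ₂ s₁ s₂) : AlmostCoprime τ₁ τ₂ := by
  refine ⟨tendsto_gcd_div_of_exists_nash hτ₁ hτ₂ H, ?_⟩
  have := tendsto_gcd_div_of_exists_nash.{v, u} hτ₂ hτ₁ fun G => by
    obtain ⟨s₁, s₂, h⟩ := H G.swap
    exact ⟨s₂, s₁, h.swap⟩
  simpa only [Nat.gcd_comm] using this

end MatchingPennies

end UnfoldingGame

theorem mainTheorem1 (τ₁ τ₂ : ℕ → ℕ)
    (hτ₁ : UnfoldingGame.IsAlmostRational τ₁) (hτ₂ : UnfoldingGame.IsAlmostRational τ₂) :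
    (UnfoldingGame.AlmostCoprime τ₁ τ₂ ↔
      ∀ (S₁ : Type u) (S₂ : Type v) [Fintype S₁] [Fintype S₂] [Nonempty S₁] [Nonempty S₂]
        (G : UnfoldingGame.Game S₁ S₂),
        ∃ (s₁ : ℕ → ℕ → S₁) (s₂ : ℕ → ℕ → S₂), G.IsAlmostRationalNash τ₁ τ₂ s₁ s₂) ∧
    (UnfoldingGame.AlmostCoprime τ₁ τ₂ →
      ∀ (S₁ : Type u) (S₂ : Type v) [Fintype S₁] [Fintype S₂] [Nonempty S₁] [Nonempty S₂]
        (G : UnfoldingGame.Game S₁ S₂) (σ₁ : stdSimplex ℝ S₁) (σ₂ : stdSimplex ℝ S₂),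
        G.IsNash σ₁ σ₂ → G.IsRealizedInUnfolding τ₁ τ₂ σ₁ σ₂) := by
  refine ⟨⟨fun hco S₁ S₂ _ _ _ _ G => ?_, fun H => ?_⟩, fun hco S₁ S₂ _ _ _ _ G σ₁ σ₂ hσ => ?_⟩
  · obtain ⟨σ₁, σ₂, hσ⟩ := G.exists_nash
    obtain ⟨s₁, s₂, h, -⟩ := G.isRealizedInUnfolding hτ₁.1 hτ₂.1 hco hσ
    exact ⟨s₁, s₂, h⟩
  · exact UnfoldingGame.almostCoprime_of_exists_nash.{u, v} hτ₁.1 hτ₂.1 fun G => H _ _ G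
  · exact G.isRealizedInUnfolding hτ₁.1 hτ₂.1 hco hσ
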